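/- For $\alpha>0$ and a real random variable $X$ let $\|X\|_{\psi_\alpha}=\inf\{t>0:\mathbb E[\exp(|X|^\alpha/t^\alpha)]\le 2\}$ (with $\inf\emptyset=\infty$); $X$ is called sub-Gaussian if $\|X\|_{\psi_2}<\infty$. For $1\le r\le\infty$ let $\|\cdot\|_r$ be the $\ell_r$-norm on $\mathbb R^m$, let $B_r^m=\{z\in\mathbb R^m:\|z\|_r\le 1\}$, and for $S\subseteq\mathbb R^m$ let $\mathrm{rad}(S)=\sup_{y\in S}\|y\|_2$. **Theorem.** Let $1\le p<\infty$ and let $q\in(1,\infty]$ be its Hölder conjugate, $\frac1p+\frac1q=1$. There is a constant $C_p>0$, depending only on $p$, such that the following holds. Let $X_1,X_2,\dots$ be i.i.d. sub-Gaussian real random variables on a probability space with $\|X_1\|_{L^p}=(\mathbb E|X_1|^p)^{1/p}=1$, and put $K=\|X_1\|_{\psi_2}$. Then, for every $m\ge 1$, the random vector $X^{(m)}=(X_1,\dots,X_m)$ satisfies $$\big\|\,\|X^{(m)}\|_p-m^{1/p}\,\big\|_{\psi_2}\le C_p\,K^p\,\mathrm{rad}(B_q^m),$$ the expectation $\mathbb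 E\|X^{(m)}\|_p$ is finite, and $$\big\|\,\|X^{(m)}\|_p-\mathbb E\|X^{(m)}\|_p\,\big\|_{\psi_2}\le C_p\,K^p\,\mathrm{rad}(B_q^m).$$ -/

import Mathlib

open MeasureTheory ProbabilityTheory
open scoped ENNReal NNReal

noncomputable section

/-- The `α`-Orlicz norm of a real random variable,
`‖X‖_{ψ_α} = inf {t > 0 : 𝔼[exp(|X|^α / t^α)] ≤ 2}`, with `inf ∅ = ∞`.
The expectation of the nonnegative random variable is the Lebesgue integral with
values in `[0, ∞]`. -/
def orliczNorm {Ω : Type*} [MeasurableSpace Ω] (μ : Measure Ω) (α : ℝ) (X : Ω → ℝ) : ℝ≥0∞ :=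
  ⨅ (t : ℝ≥0) (_ : 0 < t ∧
    ∫⁻ ω, ENNReal.ofReal (Real.exp (|X ω| ^ α / (t : ℝ) ^ α)) ∂μ ≤ 2), (t : ℝ≥0∞)

/-- A random variable is sub-Gaussian when its `ψ₂`-norm is finite. -/
def IsSubGaussian {Ω : Type*} [MeasurableSpace Ω] (μ : Measure Ω) (X : Ω → ℝ) : Prop :=
  orliczNorm μ 2 X < ∞

/-- The `ℓ_r`-norm on `ℝ^m`, for `1 ≤ r ≤ ∞` (the maximum norm for `r = ∞`). -/
def ellNorm (r : ℝ≥0∞) {m : ℕ} (z : Fin m → ℝ) : ℝ :=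
  ‖(WithLp.toLp r z : PiLp r fun _ : Fin m => ℝ)‖

/-- The closed unit ball `B_r^m` of the `ℓ_r`-norm on `ℝ^m`. -/
def ellBall (r : ℝ≥0∞) (m : ℕ) : Set (Fin m → ℝ) :=
  {z | ellNorm r z ≤ 1}

/-- The Euclidean radius `rad(S) = sup_{y ∈ S} ‖y‖₂` of a subset of `ℝ^m`. -/
def rad {m : ℕ} (S : Set (Fin m → ℝ)) : ℝ≥0∞ :=
  ⨆ y ∈ S, ENNReal.ofReal (ellNorm 2 y)

end

/-! Write x = m^(1/p) and S = ∑ |X_i|^p, a sum of independent terms of mean 1. Since x^p = m, a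
deviation of S^(1/p) from x by t forces S to deviate from m by at least t x^(p-1), so everything
reduces to Chernoff bounds for S. With D of order K^p, `mgf_comp_le` gives log E exp(λ|X_i|^p) ≤ λ +
λ²D² for all λ ≤ 0, and for those λ > 0 for which λ|y|^p stays below the Gaussian weight 1/4 +
y²/(4K²).

The lower tail therefore has rate t² x^(p-2)/D² for all p. The upper tail depends on p. For p ≤ 2,
small t is handled by Chernoff with the same rate. For large t, Hölder's inequality passes to ∑
X_i², which has an exponential moment. For p ≥ 2, |X_i|^p has no exponential moment in general, so
the variables are truncated at max(t, x); a union bound controls the event that some |X_i| exceeds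
this level, at rate t²/D².

In all cases the rate is at least of order t²/(D²R²) with R = max(1, m^(1/p-1/2)). Testing B_q^m on
a basis vector and on a constant vector shows R ≤ rad(B_q^m). Integrating the tail gives the ψ₂
bound around m^(1/p), and centering at the mean costs a factor 3. -/

/-! ### Elementary inequalities -/

/-- The maximum reduces the remainder to y² for y ≤ 0, so negative exponents need no growth
condition. -/
theorem exp_le_one_add_add_sq_mul (y : ℝ) :
    Real.exp y ≤ 1 + y + y ^ 2 * max 1 (Real.exp y) := by
  rcases le_total 0 y with hy | hy
  · have h1 : Real.exp y ≤ 1 + y * Real.exp y := by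
      have h := Real.add_one_le_exp (-y)
      have h2 : Real.exp (-y) * Real.exp y = 1 := by rw [← Real.exp_add]; simp
      nlinarith [Real.exp_pos y]
    have h2 : Real.exp y ≤ max 1 (Real.exp y) := le_max_right _ _
    nlinarith [mul_le_mul_of_nonneg_left h1 hy, mul_le_mul_of_nonneg_left h2 (sq_nonneg y)]
  · have h2 : (1 : ℝ) ≤ max 1 (Real.exp y) := le_max_left _ _
    have h3 : Real.exp y ≤ 1 + y + y ^ 2 := by
      rcases le_total (-1) y with h | h
      · have := Real.abs_exp_sub_one_sub_id_le (x := y) (by rw [abs_le]; constructor <;> linarith)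
        linarith [le_abs_self (Real.exp y - 1 - y)]
      · have : Real.exp y ≤ 1 := Real.exp_le_one_iff.2 hy
        nlinarith
    nlinarith [mul_le_mul_of_nonneg_left h2 (sq_nonneg y)]

theorem rpow_le_rpow_self_mul_exp {r z : ℝ} (hr : 0 < r) (hz : 0 ≤ z) :
    z ^ r ≤ r ^ r * Real.exp z := by
  have h1 : z / r ≤ Real.exp (z / r) := by linarith [Real.add_one_le_exp (z / r)]
  have h2 : (z / r) ^ r ≤ Real.exp (z / r) ^ r :=
    Real.rpow_le_rpow (div_nonneg hz hr.le) h1 hr.le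
  rw [← Real.exp_mul, div_mul_cancel₀ _ hr.ne', Real.div_rpow hz hr.le,
    div_le_iff₀ (Real.rpow_pos_of_pos hr r)] at h2
  linarith

theorem exp_quarter_le_two : Real.exp (1 / 4) ≤ 2 := by
  have h : Real.exp (1 / 4) ≤ Real.exp (Real.log 2) :=
    Real.exp_le_exp.2 (by linarith [Real.log_two_gt_d9])
  rwa [Real.exp_log (by norm_num)] at h

/-- Pointwise growth control by a Gaussian weight with variance proxy `K ^ 2`. -/
theorem abs_rpow_sq_le {p K : ℝ} (hp : 1 ≤ p) (hK : 0 < K) (x : ℝ) :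
    (|x| ^ p) ^ 2 ≤ (2 * (4 * p) ^ (p / 2) * K ^ p) ^ 2 / 4 * Real.exp (x ^ 2 / (4 * K ^ 2)) := by
  have hp0 : 0 < p := by linarith
  have h := rpow_le_rpow_self_mul_exp (z := x ^ 2 / (4 * K ^ 2)) hp0 (by positivity)
  have e1 : (|x| ^ p) ^ 2 = (x ^ 2) ^ p := by
    rw [← sq_abs x, ← Real.rpow_natCast (|x| ^ p), ← Real.rpow_natCast |x|,
      ← Real.rpow_mul (abs_nonneg x), ← Real.rpow_mul (abs_nonneg x), mul_comm]
  have e2 : (2 * (4 * p) ^ (p / 2) * K ^ p) ^ 2 / 4 = (4 * K ^ 2) ^ p * p ^ p := by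
    have a1 : ((4 * p) ^ (p / 2)) ^ 2 = (4 * p) ^ p := by
      rw [← Real.rpow_natCast ((4 * p) ^ (p / 2)), ← Real.rpow_mul (by positivity)]
      congr 1; push_cast; ring
    have a2 : (K ^ p) ^ 2 = (K ^ 2) ^ p := by
      rw [← Real.rpow_natCast (K ^ p), ← Real.rpow_natCast K, ← Real.rpow_mul hK.le,
        ← Real.rpow_mul hK.le, mul_comm]
    rw [mul_pow, mul_pow, a1, a2, Real.mul_rpow (by norm_num) hp0.le,
      Real.mul_rpow (by norm_num) (by positivity)]
    ring
  rw [Real.div_rpow (by positivity) (by positivity), div_le_iff₀ (by positivity)] at h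
  rw [e1, e2]
  linarith

/-! ### Moment generating functions and Chernoff bounds -/

section

variable {Ω : Type*} [MeasurableSpace Ω] {μ : Measure Ω} [IsProbabilityMeasure μ]

theorem integrable_of_sq_le_mul_exp {Y : Ω → ℝ} {g : ℝ → ℝ} {K D : ℝ} (hK : 0 < K)
    (hY : Measurable Y) (hg : Measurable g) (hg0 : ∀ x, 0 ≤ g x)
    (hgD : ∀ x, g x ^ 2 ≤ D ^ 2 / 4 * Real.exp (x ^ 2 / (4 * K ^ 2)))
    (hint : Integrable (fun ω => Real.exp (Y ω ^ 2 / K ^ 2)) μ) :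
    Integrable (fun ω => g (Y ω)) μ := by
  refine ((integrable_const (1 : ℝ)).add (hint.const_mul (D ^ 2 / 4))).mono'
    (hg.comp hY).aestronglyMeasurable (ae_of_all _ fun ω => ?_)
  rw [Real.norm_of_nonneg (hg0 _)]
  have h1 := hgD (Y ω)
  have h2 : Real.exp (Y ω ^ 2 / (4 * K ^ 2)) ≤ Real.exp (Y ω ^ 2 / K ^ 2) := by
    refine Real.exp_le_exp.2 (div_le_div_of_nonneg_left (sq_nonneg _) (by positivity) ?_)
    nlinarith [sq_nonneg K]
  have h3 := mul_le_mul_of_nonneg_left h2 (by positivity : 0 ≤ D ^ 2 / 4)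
  simp only [Pi.add_apply]
  nlinarith [sq_nonneg (g (Y ω) - 1), sq_nonneg (g (Y ω)), hg0 (Y ω)]

/-- Second-order expansion of the exponential: the remainder is a product of g² and exp(l g), each
bounded by a multiple of exp(x²/(4K²)), so it is dominated by exp(x²/K²), whose mean is at most 2.
The form of `hmean` serves both signs of l: mean at most 1 suffices for l ≥ 0, which allows
truncation, while l < 0 needs mean at least 1. -/
theorem mgf_comp_le {Y : Ω → ℝ} {g : ℝ → ℝ} {K D l : ℝ} (hK : 0 < K)
    (hY : Measurable Y) (hg : Measurable g) (hg0 : ∀ x, 0 ≤ g x)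
    (hgD : ∀ x, g x ^ 2 ≤ D ^ 2 / 4 * Real.exp (x ^ 2 / (4 * K ^ 2)))
    (hl : ∀ x, l * g x ≤ 1 / 4 + x ^ 2 / (4 * K ^ 2))
    (hint : Integrable (fun ω => Real.exp (Y ω ^ 2 / K ^ 2)) μ)
    (hint2 : ∫ ω, Real.exp (Y ω ^ 2 / K ^ 2) ∂μ ≤ 2)
    (hmean : l * ∫ ω, g (Y ω) ∂μ ≤ l) :
    Integrable (fun ω => Real.exp (l * g (Y ω))) μ ∧
      mgf (fun ω => g (Y ω)) μ l ≤ Real.exp (l + l ^ 2 * D ^ 2) := by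
  have hw : ∀ x : ℝ, Real.exp (l * g x) ≤ 2 * Real.exp (x ^ 2 / (4 * K ^ 2)) := fun x => by
    calc Real.exp (l * g x) ≤ Real.exp (1 / 4 + x ^ 2 / (4 * K ^ 2)) := Real.exp_le_exp.2 (hl x)
      _ ≤ _ := by
        rw [Real.exp_add]
        exact mul_le_mul_of_nonneg_right exp_quarter_le_two (Real.exp_pos _).le
  have hge1 : ∀ x : ℝ, 1 ≤ Real.exp (x ^ 2 / (4 * K ^ 2)) := fun x =>
    Real.one_le_exp (by positivity)
  have h4 : ∀ x : ℝ, Real.exp (x ^ 2 / (4 * K ^ 2)) * Real.exp (x ^ 2 / (4 * K ^ 2))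
      ≤ Real.exp (x ^ 2 / K ^ 2) := fun x => by
    rw [← Real.exp_add]
    apply Real.exp_le_exp.2
    have : x ^ 2 / (4 * K ^ 2) = x ^ 2 / K ^ 2 / 4 := by field_simp
    have h0 : 0 ≤ x ^ 2 / K ^ 2 := by positivity
    linarith
  have hpt : ∀ x : ℝ, Real.exp (l * g x)
      ≤ 1 + l * g x + l ^ 2 * (D ^ 2 / 2) * Real.exp (x ^ 2 / K ^ 2) := fun x => by
    have h1 := exp_le_one_add_add_sq_mul (l * g x)
    have h2 : max 1 (Real.exp (l * g x)) ≤ 2 * Real.exp (x ^ 2 / (4 * K ^ 2)) :=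
      max_le (by linarith [hge1 x]) (hw x)
    have h3 : g x ^ 2 * max 1 (Real.exp (l * g x)) ≤ D ^ 2 / 2 * Real.exp (x ^ 2 / K ^ 2) := by
      calc g x ^ 2 * max 1 (Real.exp (l * g x))
          ≤ (D ^ 2 / 4 * Real.exp (x ^ 2 / (4 * K ^ 2)))
            * (2 * Real.exp (x ^ 2 / (4 * K ^ 2))) :=
            mul_le_mul (hgD x) h2 (by positivity) (by positivity)
        _ = D ^ 2 / 2 * (Real.exp (x ^ 2 / (4 * K ^ 2)) * Real.exp (x ^ 2 / (4 * K ^ 2))) := by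
            ring
        _ ≤ _ := mul_le_mul_of_nonneg_left (h4 x) (by positivity)
    have h5 := mul_le_mul_of_nonneg_left h3 (sq_nonneg l)
    nlinarith
  have hgi := integrable_of_sq_le_mul_exp hK hY hg hg0 hgD hint
  have hei : Integrable (fun ω => Real.exp (l * g (Y ω))) μ := by
    refine (hint.const_mul 2).mono'
      (Real.measurable_exp.comp ((hg.comp hY).const_mul l)).aestronglyMeasurable
      (ae_of_all _ fun ω => ?_)
    rw [Real.norm_of_nonneg (Real.exp_pos _).le]
    nlinarith [hw (Y ω), h4 (Y ω), hge1 (Y ω)]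
  refine ⟨hei, ?_⟩
  have hi1 : Integrable (fun ω => 1 + l * g (Y ω)) μ :=
    (integrable_const (1 : ℝ)).add (hgi.const_mul l)
  have hi2 : Integrable (fun ω => l ^ 2 * (D ^ 2 / 2) * Real.exp (Y ω ^ 2 / K ^ 2)) μ :=
    hint.const_mul _
  calc mgf (fun ω => g (Y ω)) μ l
      ≤ ∫ ω, (1 + l * g (Y ω) + l ^ 2 * (D ^ 2 / 2) * Real.exp (Y ω ^ 2 / K ^ 2)) ∂μ :=
        integral_mono hei (hi1.add hi2) fun ω => hpt (Y ω)
    _ = 1 + l * ∫ ω, g (Y ω) ∂μ + l ^ 2 * (D ^ 2 / 2) * ∫ ω, Real.exp (Y ω ^ 2 / K ^ 2) ∂μ := by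
        rw [integral_add hi1 hi2, integral_add (integrable_const 1) (hgi.const_mul l),
          integral_const_mul, integral_const_mul]
        simp
    _ ≤ 1 + l + l ^ 2 * D ^ 2 := by
        have := mul_le_mul_of_nonneg_left hint2 (by positivity : 0 ≤ l ^ 2 * (D ^ 2 / 2))
        linarith
    _ ≤ _ := by linarith [Real.add_one_le_exp (l + l ^ 2 * D ^ 2)]

theorem mgf_sum_comp_le {X : ℕ → Ω → ℝ} {g : ℝ → ℝ} {l c : ℝ}
    (hX : ∀ i, Measurable (X i)) (hind : iIndepFun X μ) (hg : Measurable g)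
    (hi : ∀ i, Integrable (fun ω => Real.exp (l * g (X i ω))) μ)
    (hle : ∀ i, mgf (fun ω => g (X i ω)) μ l ≤ c) (m : ℕ) :
    Integrable (fun ω => Real.exp (l * ∑ i ∈ Finset.range m, g (X i ω))) μ ∧
      mgf (fun ω => ∑ i ∈ Finset.range m, g (X i ω)) μ l ≤ c ^ m := by
  have hind' : iIndepFun (fun i ω => g (X i ω)) μ := hind.comp (fun _ => g) fun _ => hg
  have hm : ∀ i, Measurable fun ω => g (X i ω) := fun i => hg.comp (hX i)
  have e : (fun ω => ∑ i ∈ Finset.range m, g (X i ω))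
      = ∑ i ∈ Finset.range m, fun ω => g (X i ω) := by ext ω; simp
  constructor
  · simpa using hind'.integrable_exp_mul_sum hm (s := Finset.range m) fun i _ => hi i
  · rw [e, hind'.mgf_sum hm]
    calc _ ≤ ∏ _i ∈ Finset.range m, c := Finset.prod_le_prod (fun i _ => mgf_nonneg) fun i _ => hle i
      _ = c ^ m := by simp

theorem measureReal_le_sum_le {X : ℕ → Ω → ℝ} {g : ℝ → ℝ} {K D l : ℝ} (hK : 0 < K)
    (hX : ∀ i, Measurable (X i)) (hind : iIndepFun X μ) (hg : Measurable g) (hg0 : ∀ x, 0 ≤ g x)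
    (hgD : ∀ x, g x ^ 2 ≤ D ^ 2 / 4 * Real.exp (x ^ 2 / (4 * K ^ 2)))
    (hl : ∀ x, l * g x ≤ 1 / 4 + x ^ 2 / (4 * K ^ 2))
    (hint : ∀ i, Integrable (fun ω => Real.exp (X i ω ^ 2 / K ^ 2)) μ)
    (hint2 : ∀ i, ∫ ω, Real.exp (X i ω ^ 2 / K ^ 2) ∂μ ≤ 2)
    (hmean : ∀ i, ∫ ω, g (X i ω) ∂μ ≤ 1) (hl0 : 0 ≤ l) (m : ℕ) (u : ℝ) :
    μ.real {ω | m + u ≤ ∑ i ∈ Finset.range m, g (X i ω)}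
      ≤ Real.exp (-(l * u) + m * (l ^ 2 * D ^ 2)) := by
  have h := fun i => mgf_comp_le hK (hX i) hg hg0 hgD hl (hint i) (hint2 i)
    (mul_le_of_le_one_right hl0 (hmean i))
  obtain ⟨h1, h2⟩ := mgf_sum_comp_le hX hind hg (fun i => (h i).1) (fun i => (h i).2) m
  refine (measure_ge_le_exp_mul_mgf _ hl0 h1).trans
    ((mul_le_mul_of_nonneg_left h2 (Real.exp_pos _).le).trans_eq ?_)
  rw [← Real.exp_nat_mul, ← Real.exp_add]
  congr 1; ring

theorem measureReal_sum_le_le {X : ℕ → Ω → ℝ} {g : ℝ → ℝ} {K D l : ℝ} (hK : 0 < K)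
    (hX : ∀ i, Measurable (X i)) (hind : iIndepFun X μ) (hg : Measurable g) (hg0 : ∀ x, 0 ≤ g x)
    (hgD : ∀ x, g x ^ 2 ≤ D ^ 2 / 4 * Real.exp (x ^ 2 / (4 * K ^ 2)))
    (hint : ∀ i, Integrable (fun ω => Real.exp (X i ω ^ 2 / K ^ 2)) μ)
    (hint2 : ∀ i, ∫ ω, Real.exp (X i ω ^ 2 / K ^ 2) ∂μ ≤ 2)
    (hmean : ∀ i, ∫ ω, g (X i ω) ∂μ = 1) (hl0 : 0 ≤ l) (m : ℕ) (u : ℝ) :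
    μ.real {ω | ∑ i ∈ Finset.range m, g (X i ω) ≤ m - u}
      ≤ Real.exp (-(l * u) + m * (l ^ 2 * D ^ 2)) := by
  have h := fun i => mgf_comp_le (l := -l) hK (hX i) hg hg0 hgD
    (fun x => (by nlinarith [hg0 x] : -l * g x ≤ 0).trans (by positivity)) (hint i) (hint2 i)
    (by rw [hmean i, mul_one])
  obtain ⟨h1, h2⟩ := mgf_sum_comp_le hX hind hg (fun i => (h i).1) (fun i => (h i).2) m
  refine (measure_le_le_exp_mul_mgf _ (neg_nonpos.2 hl0) h1).trans
    ((mul_le_mul_of_nonneg_left h2 (Real.exp_pos _).le).trans_eq ?_)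
  rw [← Real.exp_nat_mul, ← Real.exp_add]
  congr 1; ring

/-- Chernoff at the single parameter 1/K², where each factor is at most 2 by the choice of K. -/
theorem measureReal_le_sum_sq_le {X : ℕ → Ω → ℝ} {K : ℝ}
    (hX : ∀ i, Measurable (X i)) (hind : iIndepFun X μ)
    (hint : ∀ i, Integrable (fun ω => Real.exp (X i ω ^ 2 / K ^ 2)) μ)
    (hint2 : ∀ i, ∫ ω, Real.exp (X i ω ^ 2 / K ^ 2) ∂μ ≤ 2) (m : ℕ) (v : ℝ) :
    μ.real {ω | v ≤ ∑ i ∈ Finset.range m, X i ω ^ 2}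
      ≤ 2 ^ m * Real.exp (-(v / K ^ 2)) := by
  have e : ∀ i ω, Real.exp ((K ^ 2)⁻¹ * X i ω ^ 2) = Real.exp (X i ω ^ 2 / K ^ 2) := fun i ω => by
    congr 1; ring
  obtain ⟨h1, h2⟩ := mgf_sum_comp_le (g := fun x => x ^ 2) (l := (K ^ 2)⁻¹) (c := 2) hX hind
    (by fun_prop) (fun i => by simpa only [e] using hint i)
    (fun i => by simpa only [mgf, e] using hint2 i) m
  refine (measure_ge_le_exp_mul_mgf _ (by positivity) h1).trans
    ((mul_le_mul_of_nonneg_left h2 (Real.exp_pos _).le).trans_eq ?_)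
  rw [mul_comm]
  congr 2; ring

theorem measureReal_le_abs_le {Y : Ω → ℝ} {K s : ℝ} (hs : 0 ≤ s)
    (hint : Integrable (fun ω => Real.exp (Y ω ^ 2 / K ^ 2)) μ)
    (hint2 : ∫ ω, Real.exp (Y ω ^ 2 / K ^ 2) ∂μ ≤ 2) :
    μ.real {ω | s ≤ |Y ω|} ≤ 2 * Real.exp (-(s ^ 2 / K ^ 2)) := by
  have e : ∀ ω, Real.exp ((K ^ 2)⁻¹ * Y ω ^ 2) = Real.exp (Y ω ^ 2 / K ^ 2) := fun ω => by
    congr 1; ring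
  have h := measure_ge_le_exp_mul_mgf (μ := μ) (X := fun ω => Y ω ^ 2) (s ^ 2)
    (by positivity : 0 ≤ (K ^ 2)⁻¹) (by simpa only [e] using hint)
  simp only [mgf, e] at h
  have hsub : {ω | s ≤ |Y ω|} ⊆ {ω | s ^ 2 ≤ Y ω ^ 2} := fun ω (hω : s ≤ |Y ω|) => by
    simpa only [Set.mem_ofPred_eq, sq_abs] using pow_le_pow_left₀ hs hω 2
  refine (measureReal_mono hsub).trans (h.trans ?_)
  have e2 : -(K ^ 2)⁻¹ * s ^ 2 = -(s ^ 2 / K ^ 2) := by ring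
  rw [e2, mul_comm]
  exact mul_le_mul_of_nonneg_right hint2 (Real.exp_pos _).le

end

/-! ### Tails of the ℓ_p-norm -/

/-- Split (x + t)^p as (x + t)(x + t)^(p-1) and use x + t ≥ max(t, x). The maximum will be the
truncation level when p ≥ 2. -/
theorem rpow_add_mul_max_rpow_le {p x t : ℝ} (hp : 1 ≤ p) (hx : 0 < x) (ht : 0 ≤ t) :
    x ^ p + t * max t x ^ (p - 1) ≤ (x + t) ^ p := by
  have h1 : (x + t) ^ p = (x + t) * (x + t) ^ (p - 1) := by
    rw [← Real.rpow_one_add' (by linarith) (by linarith)]; congr 1; ring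
  have h2 : x ^ p = x * x ^ (p - 1) := by
    rw [← Real.rpow_one_add' hx.le (by linarith)]; congr 1; ring
  have h3 : x ^ (p - 1) ≤ (x + t) ^ (p - 1) :=
    Real.rpow_le_rpow hx.le (by linarith) (by linarith)
  have h4 : max t x ^ (p - 1) ≤ (x + t) ^ (p - 1) :=
    Real.rpow_le_rpow (le_max_of_le_right hx.le) (max_le (by linarith) (by linarith)) (by linarith)
  rw [h1, h2]
  nlinarith [mul_le_mul_of_nonneg_left h3 hx.le, mul_le_mul_of_nonneg_left h4 ht]

theorem rpow_sub_le {p x t : ℝ} (hp : 1 ≤ p) (hx : 0 < x) (ht : 0 ≤ t) (htx : t ≤ x) :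
    (x - t) ^ p ≤ x ^ p - t * x ^ (p - 1) := by
  have h1 : (x - t) ^ p = (x - t) * (x - t) ^ (p - 1) := by
    rw [← Real.rpow_one_add' (by linarith) (by linarith)]; congr 1; ring
  have h2 : x ^ p = x * x ^ (p - 1) := by
    rw [← Real.rpow_one_add' hx.le (by linarith)]; congr 1; ring
  have h3 : (x - t) ^ (p - 1) ≤ x ^ (p - 1) :=
    Real.rpow_le_rpow (by linarith) (by linarith) (by linarith)
  rw [h1, h2]
  nlinarith [mul_le_mul_of_nonneg_left h3 (by linarith : 0 ≤ x - t)]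

section

variable {Ω : Type*} [MeasurableSpace Ω] {μ : Measure Ω} [IsProbabilityMeasure μ]

theorem measureReal_sum_abs_rpow_le_le {X : ℕ → Ω → ℝ} {p K D x t : ℝ} {m : ℕ}
    (hp : 1 ≤ p) (hK : 0 < K) (hD : 0 < D)
    (hX : ∀ i, Measurable (X i)) (hind : iIndepFun X μ)
    (hgD : ∀ y : ℝ, (|y| ^ p) ^ 2 ≤ D ^ 2 / 4 * Real.exp (y ^ 2 / (4 * K ^ 2)))
    (hint : ∀ i, Integrable (fun ω => Real.exp (X i ω ^ 2 / K ^ 2)) μ)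
    (hint2 : ∀ i, ∫ ω, Real.exp (X i ω ^ 2 / K ^ 2) ∂μ ≤ 2)
    (hmean : ∀ i, ∫ ω, |X i ω| ^ p ∂μ = 1)
    (hx : 0 < x) (hxm : x ^ p = m) (ht : 0 ≤ t) (htx : t ≤ x) :
    μ.real {ω | ∑ i ∈ Finset.range m, |X i ω| ^ p ≤ (x - t) ^ p}
      ≤ Real.exp (-(t ^ 2 * x ^ (p - 2) / (4 * D ^ 2))) := by
  have hm : (m : ℝ) = x ^ (p - 1) * x := by
    rw [← hxm, ← Real.rpow_add_one' hx.le (by linarith)]; congr 1; ring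
  have hq : x ^ (p - 1) = x ^ (p - 2) * x := by
    rw [← Real.rpow_add_one hx.ne']; congr 1; ring
  have hy : 0 < x ^ (p - 2) := Real.rpow_pos_of_pos hx _
  -- This l minimises -l t x^(p-1) + m l² D², since m = x^p.
  have h := measureReal_sum_le_le (g := fun y => |y| ^ p) (l := t / (2 * x * D ^ 2)) hK hX hind
    (by fun_prop) (fun y => by positivity) hgD hint hint2 hmean (by positivity) m (t * x ^ (p - 1))
  refine (measureReal_mono ?_).trans (h.trans_eq ?_)
  · intro ω hω
    exact le_trans hω ((rpow_sub_le hp hx ht htx).trans_eq (by rw [hxm]))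
  · congr 1
    rw [hm, hq]
    field_simp
    ring

/-- Below the level s = max(t, x) one has |y|^p ≤ s^(p-2) y², so the truncated power admits an l of
order t/(D² s^(p-1)). Above it, the union bound loses a factor m, which t ≥ 2pD makes affordable. -/
theorem measureReal_le_sum_abs_rpow_le_of_two_le {X : ℕ → Ω → ℝ} {p K D x t : ℝ} {m : ℕ}
    (hp : 2 ≤ p) (hK : 0 < K) (hD : 1 ≤ D) (hKD : K ≤ D) (hKD2 : K ^ 2 ≤ D)
    (hX : ∀ i, Measurable (X i)) (hind : iIndepFun X μ)
    (hgD : ∀ y : ℝ, (|y| ^ p) ^ 2 ≤ D ^ 2 / 4 * Real.exp (y ^ 2 / (4 * K ^ 2)))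
    (hint : ∀ i, Integrable (fun ω => Real.exp (X i ω ^ 2 / K ^ 2)) μ)
    (hint2 : ∀ i, ∫ ω, Real.exp (X i ω ^ 2 / K ^ 2) ∂μ ≤ 2)
    (hmean : ∀ i, ∫ ω, |X i ω| ^ p ∂μ = 1)
    (hx : 1 ≤ x) (hxm : x ^ p = m) (ht : 2 * p * D ≤ t) :
    μ.real {ω | (x + t) ^ p ≤ ∑ i ∈ Finset.range m, |X i ω| ^ p}
      ≤ 3 * Real.exp (-(t ^ 2 / (8 * D ^ 2))) := by
  have ht0 : 0 < t := by nlinarith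
  set s := max t x with hs
  have hts : t ≤ s := le_max_left _ _
  have hxs : x ≤ s := le_max_right _ _
  have hs1 : 1 ≤ s := hx.trans hxs
  have hs0 : 0 < s := by linarith
  have hms : (m : ℝ) ≤ s ^ p := by
    rw [← hxm]; exact Real.rpow_le_rpow (by linarith) hxs (by linarith)
  -- Truncation to 0 can only lower the mean, which is harmless for an upper tail.
  set g : ℝ → ℝ := fun y => if |y| < s then |y| ^ p else 0 with hgdef
  have hg : Measurable g := Measurable.ite (measurableSet_lt (by fun_prop) (by fun_prop))
    (by fun_prop) (by fun_prop)
  have hg0 : ∀ y, 0 ≤ g y := fun y => by simp only [hgdef]; split_ifs <;> positivity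
  have hgle : ∀ y, g y ≤ |y| ^ p := fun y => by
    simp only [hgdef]; split_ifs
    · exact le_rfl
    · positivity
  have hgD' : ∀ y, g y ^ 2 ≤ D ^ 2 / 4 * Real.exp (y ^ 2 / (4 * K ^ 2)) := fun y =>
    (pow_le_pow_left₀ (hg0 y) (hgle y) 2).trans (hgD y)
  have hp1 : s ^ (p - 1) = s ^ (p - 2) * s := by
    rw [← Real.rpow_add_one hs0.ne']; congr 1; ring
  have hy0 : 0 < s ^ (p - 2) := Real.rpow_pos_of_pos hs0 _
  have hy1 : 0 < s ^ (p - 1) := Real.rpow_pos_of_pos hs0 _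
  set l := t / (4 * D ^ 2 * s ^ (p - 1)) with hl
  have hlg : ∀ y, l * g y ≤ 1 / 4 + y ^ 2 / (4 * K ^ 2) := fun y => by
    by_cases hy : |y| < s
    · have h1 : |y| ^ p ≤ s ^ (p - 2) * y ^ 2 := by
        rw [← sq_abs y]
        calc |y| ^ p = |y| ^ (p - 2) * |y| ^ 2 := by
              rw [← Real.rpow_natCast |y| 2, ← Real.rpow_add' (abs_nonneg y) (by push_cast; linarith)]
              congr 1; push_cast; ring
          _ ≤ _ := mul_le_mul_of_nonneg_right
              (Real.rpow_le_rpow (abs_nonneg y) hy.le (by linarith)) (by positivity)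
      have h2 : l * s ^ (p - 2) ≤ 1 / (4 * K ^ 2) := by
        have e : l * s ^ (p - 2) = t / s / (4 * D ^ 2) := by
          rw [hl, hp1]; field_simp
        rw [e]
        have : t / s ≤ 1 := (div_le_one hs0).2 hts
        calc t / s / (4 * D ^ 2) ≤ 1 / (4 * D ^ 2) := by gcongr
          _ ≤ _ := by gcongr
      simp only [hgdef, if_pos hy]
      calc l * |y| ^ p ≤ l * (s ^ (p - 2) * y ^ 2) := by gcongr
        _ = l * s ^ (p - 2) * y ^ 2 := by ring
        _ ≤ 1 / (4 * K ^ 2) * y ^ 2 := by gcongr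
        _ ≤ _ := by rw [one_div_mul_eq_div]; linarith
    · simp only [hgdef, if_neg hy]; rw [mul_zero]; positivity
  have hgi : ∀ i, Integrable (fun ω => |X i ω| ^ p) μ := fun i =>
    integrable_of_sq_le_mul_exp hK (hX i) (g := fun y => |y| ^ p) (by fun_prop)
      (fun y => by positivity) hgD (hint i)
  have hmean' : ∀ i, ∫ ω, g (X i ω) ∂μ ≤ 1 := fun i => by
    rw [← hmean i]
    exact integral_mono (integrable_of_sq_le_mul_exp hK (hX i) hg hg0 hgD' (hint i)) (hgi i)
      fun ω => hgle _
  have hA := measureReal_le_sum_le hK hX hind hg hg0 hgD' hlg hint hint2 hmean'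
    (by positivity : 0 ≤ l) m (t * s ^ (p - 1))
  have hA' : Real.exp (-(l * (t * s ^ (p - 1))) + m * (l ^ 2 * D ^ 2))
      ≤ Real.exp (-(t ^ 2 / (8 * D ^ 2))) := by
    apply Real.exp_le_exp.2
    have e1 : l * (t * s ^ (p - 1)) = t ^ 2 / D ^ 2 / 4 := by rw [hl]; field_simp
    -- Here p ≥ 2 enters through p ≤ 2(p - 1), together with s ≥ 1.
    have hm2 : (m : ℝ) ≤ (s ^ (p - 1)) ^ 2 := by
      refine hms.trans ?_
      rw [← Real.rpow_natCast, ← Real.rpow_mul hs0.le]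
      exact Real.rpow_le_rpow_of_exponent_le hs1 (by push_cast; linarith)
    have e2 : m * (l ^ 2 * D ^ 2) ≤ t ^ 2 / D ^ 2 / 16 := by
      calc m * (l ^ 2 * D ^ 2) ≤ (s ^ (p - 1)) ^ 2 * (l ^ 2 * D ^ 2) := by gcongr
        _ = _ := by rw [hl]; field_simp; norm_num
    have e3 : t ^ 2 / (8 * D ^ 2) = t ^ 2 / D ^ 2 / 8 := by field_simp
    have : 0 ≤ t ^ 2 / D ^ 2 := by positivity
    rw [e1, e3]; linarith
  have hB : μ.real (⋃ i ∈ Finset.range m, {ω | s ≤ |X i ω|})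
      ≤ 2 * Real.exp (-(t ^ 2 / (8 * D ^ 2))) := by
    -- Half of the Gaussian exponent absorbs m ≤ s^p: p log s ≤ p s ≤ s²/(2K²), because s ≥ t ≥ 2pD
    -- ≥ 2pK².
    have hmexp : (m : ℝ) ≤ Real.exp (s ^ 2 / K ^ 2 / 2) := by
      refine hms.trans ?_
      rw [Real.rpow_def_of_pos hs0]
      apply Real.exp_le_exp.2
      have h1 : Real.log s ≤ s := (Real.log_le_sub_one_of_pos hs0).trans (by linarith)
      have h2 : p * s ≤ s ^ 2 / K ^ 2 / 2 := by
        rw [le_div_iff₀ (by norm_num), le_div_iff₀ (by positivity)]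
        have : 2 * p * K ^ 2 ≤ s := by nlinarith
        nlinarith
      nlinarith
    calc μ.real (⋃ i ∈ Finset.range m, {ω | s ≤ |X i ω|})
        ≤ ∑ i ∈ Finset.range m, μ.real {ω | s ≤ |X i ω|} := measureReal_biUnion_finset_le _ _
      _ ≤ ∑ _i ∈ Finset.range m, 2 * Real.exp (-(s ^ 2 / K ^ 2)) :=
          Finset.sum_le_sum fun i _ => measureReal_le_abs_le hs0.le (hint i) (hint2 i)
      _ = 2 * (m * Real.exp (-(s ^ 2 / K ^ 2))) := by simp; ring
      _ ≤ 2 * (Real.exp (s ^ 2 / K ^ 2 / 2) * Real.exp (-(s ^ 2 / K ^ 2))) := by gcongr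
      _ ≤ _ := by
        rw [← Real.exp_add]
        have h1 : t ^ 2 / (8 * D ^ 2) ≤ s ^ 2 / K ^ 2 / 2 := by
          rw [div_div]
          refine div_le_div₀ (by positivity) (by gcongr) (by positivity) ?_
          nlinarith [pow_le_pow_left₀ hK.le hKD 2, sq_nonneg D]
        gcongr
        linarith
  calc μ.real {ω | (x + t) ^ p ≤ ∑ i ∈ Finset.range m, |X i ω| ^ p}
      ≤ μ.real ({ω | m + t * s ^ (p - 1) ≤ ∑ i ∈ Finset.range m, g (X i ω)}
          ∪ ⋃ i ∈ Finset.range m, {ω | s ≤ |X i ω|}) := by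
        refine measureReal_mono fun ω hω => ?_
        by_cases h : ∃ i ∈ Finset.range m, s ≤ |X i ω|
        · obtain ⟨i, hi, h⟩ := h
          exact Or.inr (Set.mem_biUnion (Finset.mem_coe.2 hi) h)
        · left
          push Not at h
          have e : ∑ i ∈ Finset.range m, g (X i ω) = ∑ i ∈ Finset.range m, |X i ω| ^ p :=
            Finset.sum_congr rfl fun i hi => if_pos (h i hi)
          change _ ≤ ∑ i ∈ Finset.range m, g (X i ω)
          rw [e, ← hxm]
          exact (rpow_add_mul_max_rpow_le (by linarith) (by linarith) ht0.le).trans hω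
    _ ≤ _ := measureReal_union_le _ _
    _ ≤ Real.exp (-(t ^ 2 / (8 * D ^ 2))) + 2 * Real.exp (-(t ^ 2 / (8 * D ^ 2))) :=
        add_le_add (hA.trans hA') hB
    _ = _ := by ring

/-- For p ≤ 2 the bound (|y|/K)^p ≤ 1 + (|y|/K)² makes every l with l K^p ≤ 1/4 admissible. This
covers t ≤ 2xD; beyond that, the ℓ_2-norm takes over. -/
theorem measureReal_le_sum_abs_rpow_le_of_le_two {X : ℕ → Ω → ℝ} {p K D x t : ℝ} {m : ℕ}
    (hp : 1 ≤ p) (hp2 : p ≤ 2) (hK : 0 < K) (hD : 1 ≤ D) (hKD : K ≤ D) (hKpD : K ^ p ≤ D)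
    (hX : ∀ i, Measurable (X i)) (hind : iIndepFun X μ)
    (hgD : ∀ y : ℝ, (|y| ^ p) ^ 2 ≤ D ^ 2 / 4 * Real.exp (y ^ 2 / (4 * K ^ 2)))
    (hint : ∀ i, Integrable (fun ω => Real.exp (X i ω ^ 2 / K ^ 2)) μ)
    (hint2 : ∀ i, ∫ ω, Real.exp (X i ω ^ 2 / K ^ 2) ∂μ ≤ 2)
    (hmean : ∀ i, ∫ ω, |X i ω| ^ p ∂μ = 1)
    (hx : 1 ≤ x) (hxm : x ^ p = m) (ht : 0 ≤ t) :
    μ.real {ω | (x + t) ^ p ≤ ∑ i ∈ Finset.range m, |X i ω| ^ p}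
      ≤ Real.exp (-(t ^ 2 * x ^ (p - 2) / (16 * D ^ 2))) := by
  have hx0 : 0 < x := by linarith
  have hp0 : 0 < p := by linarith
  have hm : (m : ℝ) = x ^ (p - 2) * x * x := by
    rw [← hxm, ← Real.rpow_add_one hx0.ne', ← Real.rpow_add_one hx0.ne']; congr 1; ring
  have hq : x ^ (p - 1) = x ^ (p - 2) * x := by
    rw [← Real.rpow_add_one hx0.ne']; congr 1; ring
  have hy : 0 < x ^ (p - 2) := Real.rpow_pos_of_pos hx0 _
  rcases le_total t (2 * x * D) with htB | htB
  · set l := t / (8 * x * D ^ 2) with hl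
    have hl0 : 0 ≤ l := by positivity
    have hlK : l * K ^ p ≤ 1 / 4 := by
      calc l * K ^ p ≤ l * D := by gcongr
        _ = t / (8 * x * D) := by rw [hl]; field_simp
        _ ≤ 1 / 4 := by rw [div_le_iff₀ (by positivity)]; linarith
    have hlg : ∀ y : ℝ, l * |y| ^ p ≤ 1 / 4 + y ^ 2 / (4 * K ^ 2) := fun y => by
      have h1 : (|y| / K) ^ p ≤ 1 + (|y| / K) ^ 2 := by
        rcases le_total (|y| / K) 1 with h | h
        · have := Real.rpow_le_one (by positivity) h hp0.le
          nlinarith [sq_nonneg (|y| / K)]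
        · have := Real.rpow_le_rpow_of_exponent_le h hp2
          rw [Real.rpow_two] at this
          linarith
      have h2 : |y| ^ p = K ^ p * (|y| / K) ^ p := by
        rw [← Real.mul_rpow hK.le (by positivity), mul_div_cancel₀ _ hK.ne']
      calc l * |y| ^ p = l * K ^ p * (|y| / K) ^ p := by rw [h2]; ring
        _ ≤ 1 / 4 * (1 + (|y| / K) ^ 2) := by gcongr
        _ = _ := by rw [div_pow, sq_abs]; field_simp
    have h := measureReal_le_sum_le (g := fun y => |y| ^ p) hK hX hind (by fun_prop)
      (fun y => by positivity) hgD hlg hint hint2 (fun i => (hmean i).le) hl0 m (t * x ^ (p - 1))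
    refine (measureReal_mono ?_).trans (h.trans ?_)
    · intro ω hω
      refine le_trans ?_ (le_trans (rpow_add_mul_max_rpow_le hp hx0 ht) hω)
      rw [hxm]
      gcongr
      exact le_max_right _ _
    · apply Real.exp_le_exp.2
      have e1 : l * (t * x ^ (p - 1)) = t ^ 2 * x ^ (p - 2) / D ^ 2 / 8 := by
        rw [hl, hq]; field_simp
      have e2 : m * (l ^ 2 * D ^ 2) = t ^ 2 * x ^ (p - 2) / D ^ 2 / 64 := by
        rw [hl, hm]; field_simp; norm_num
      have e3 : t ^ 2 * x ^ (p - 2) / (16 * D ^ 2) = t ^ 2 * x ^ (p - 2) / D ^ 2 / 16 := by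
        field_simp
      have : 0 ≤ t ^ 2 * x ^ (p - 2) / D ^ 2 := by positivity
      rw [e1, e2, e3]; linarith
  -- Large t: Hölder gives t² ≤ S^(2/p) ≤ m^(2/p-1) ∑ X_i², and m^(2/p-1) = x^(2-p). The prefactor
  -- 2^m is absorbed since t² x^(p-2)/D² ≥ 4m.
  · have h := measureReal_le_sum_sq_le hX hind hint hint2 m (t ^ 2 * x ^ (p - 2))
    refine (measureReal_mono ?_).trans (h.trans ?_)
    · intro ω hω
      have h1 := Real.rpow_sum_le_const_mul_sum_rpow (Finset.range m) (fun i => |X i ω| ^ p)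
        (p := 2 / p) ((one_le_div hp0).2 hp2)
      have e1 : ∀ i, (|X i ω| ^ p) ^ (2 / p) = X i ω ^ 2 := fun i => by
        rw [← Real.rpow_mul (abs_nonneg _),
          mul_div_cancel₀ _ hp0.ne', Real.rpow_two, sq_abs]
      have e2 : ∀ i, |(|X i ω| ^ p)| = |X i ω| ^ p := fun i => abs_of_nonneg (by positivity)
      simp only [e1, e2, Finset.card_range] at h1
      have h2 : t ^ 2 ≤ (∑ i ∈ Finset.range m, |X i ω| ^ p) ^ (2 / p) := by
        calc t ^ 2 = (t ^ p) ^ (2 / p) := by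
              rw [← Real.rpow_mul ht, mul_div_cancel₀ _ hp0.ne', Real.rpow_two]
          _ ≤ _ := Real.rpow_le_rpow (by positivity)
              (le_trans (Real.rpow_le_rpow ht (by linarith) hp0.le) hω) (by positivity)
      have e3 : (m : ℝ) ^ (2 / p - 1) * x ^ (p - 2) = 1 := by
        rw [← hxm, ← Real.rpow_mul hx0.le, ← Real.rpow_add hx0]
        have : p * (2 / p - 1) + (p - 2) = 0 := by field_simp; ring
        rw [this, Real.rpow_zero]
      change t ^ 2 * x ^ (p - 2) ≤ ∑ i ∈ Finset.range m, X i ω ^ 2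
      calc t ^ 2 * x ^ (p - 2)
          ≤ ((m : ℝ) ^ (2 / p - 1) * ∑ i ∈ Finset.range m, X i ω ^ 2) * x ^ (p - 2) := by
            gcongr; exact h2.trans h1
        _ = ((m : ℝ) ^ (2 / p - 1) * x ^ (p - 2)) * ∑ i ∈ Finset.range m, X i ω ^ 2 := by ring
        _ = _ := by rw [e3, one_mul]
    · have h2 : (2 : ℝ) ^ m ≤ Real.exp m := by
        rw [← mul_one (m : ℝ), Real.exp_nat_mul]
        exact pow_le_pow_left₀ (by norm_num) (by linarith [Real.add_one_le_exp 1]) m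
      set w := t ^ 2 * x ^ (p - 2) / D ^ 2 with hw
      have h3 : w ≤ t ^ 2 * x ^ (p - 2) / K ^ 2 := by rw [hw]; gcongr
      have h4 : 4 * m ≤ w := by
        rw [hw, le_div_iff₀ (by positivity), hm]
        have := pow_le_pow_left₀ (by positivity) htB 2
        nlinarith
      have h5 : t ^ 2 * x ^ (p - 2) / (16 * D ^ 2) = w / 16 := by rw [hw]; field_simp
      have hm0 : (0 : ℝ) ≤ m := Nat.cast_nonneg m
      calc (2 : ℝ) ^ m * Real.exp (-(t ^ 2 * x ^ (p - 2) / K ^ 2))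
          ≤ Real.exp m * Real.exp (-(t ^ 2 * x ^ (p - 2) / K ^ 2)) := by gcongr
        _ ≤ _ := by
          rw [← Real.exp_add, h5]
          apply Real.exp_le_exp.2
          linarith

/-- Two-sided sub-Gaussian tail for the deviation of the `ℓ_p`-norm from `x = m ^ (1 / p)`. -/
theorem measureReal_le_abs_norm_sub_le {X : ℕ → Ω → ℝ} {p K D x R t : ℝ} {m : ℕ}
    (hp : 1 ≤ p) (hK : 0 < K) (hD : 1 ≤ D) (hKD : K ≤ D) (hKpD : K ^ p ≤ D)
    (hX : ∀ i, Measurable (X i)) (hind : iIndepFun X μ)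
    (hgD : ∀ y : ℝ, (|y| ^ p) ^ 2 ≤ D ^ 2 / 4 * Real.exp (y ^ 2 / (4 * K ^ 2)))
    (hint : ∀ i, Integrable (fun ω => Real.exp (X i ω ^ 2 / K ^ 2)) μ)
    (hint2 : ∀ i, ∫ ω, Real.exp (X i ω ^ 2 / K ^ 2) ∂μ ≤ 2)
    (hmean : ∀ i, ∫ ω, |X i ω| ^ p ∂μ = 1)
    (hx : 1 ≤ x) (hxm : x ^ p = m) (hR1 : 1 ≤ R) (hR : x ^ (1 - p / 2) ≤ R) (ht : 0 < t) :
    μ.real {ω | t ≤ |(∑ i ∈ Finset.range m, |X i ω| ^ p) ^ (1 / p) - x|}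
      ≤ (4 + Real.exp (p ^ 2 / 2)) * Real.exp (-(t ^ 2 / (16 * D ^ 2 * R ^ 2))) := by
  have hx0 : 0 < x := by linarith
  have hp0 : 0 < p := by linarith
  have hR0 : 0 < R := by linarith
  have hD0 : 0 < D := by linarith
  -- This turns the rate t² x^(p-2) into the weaker t²/R².
  have hRx : 1 ≤ R ^ 2 * x ^ (p - 2) := by
    have h1 := pow_le_pow_left₀ (by positivity) hR 2
    have h2 : (x ^ (1 - p / 2)) ^ 2 * x ^ (p - 2) = 1 := by
      rw [← Real.rpow_natCast, ← Real.rpow_mul hx0.le, ← Real.rpow_add hx0]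
      have : (1 - p / 2) * ((2 : ℕ) : ℝ) + (p - 2) = 0 := by push_cast; ring
      rw [this, Real.rpow_zero]
    rw [← h2]
    gcongr
  set E := Real.exp (-(t ^ 2 / (16 * D ^ 2 * R ^ 2))) with hE
  have hE0 : 0 < E := Real.exp_pos _
  have hcmp : t ^ 2 / (16 * D ^ 2 * R ^ 2) ≤ t ^ 2 * x ^ (p - 2) / (16 * D ^ 2) := by
    rw [div_le_div_iff₀ (by positivity) (by positivity)]
    have : 0 ≤ t ^ 2 * (16 * D ^ 2) := by positivity
    nlinarith
  have hN : ∀ ω, ((∑ i ∈ Finset.range m, |X i ω| ^ p) ^ (1 / p)) ^ p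
      = ∑ i ∈ Finset.range m, |X i ω| ^ p := fun ω => by
    rw [← Real.rpow_mul (Finset.sum_nonneg fun i _ => by positivity),
      one_div_mul_cancel hp0.ne', Real.rpow_one]
  have hN0 : ∀ ω, 0 ≤ (∑ i ∈ Finset.range m, |X i ω| ^ p) ^ (1 / p) := fun ω =>
    Real.rpow_nonneg (Finset.sum_nonneg fun i _ => by positivity) _
  have hlow : μ.real {ω | (∑ i ∈ Finset.range m, |X i ω| ^ p) ^ (1 / p) ≤ x - t} ≤ E := by
    rcases le_or_gt t x with htx | htx
    · refine (measureReal_mono fun ω hω => ?_).trans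
        ((measureReal_sum_abs_rpow_le_le hp hK hD0 hX hind hgD hint hint2 hmean hx0 hxm
          ht.le htx).trans ?_)
      · change ∑ i ∈ Finset.range m, |X i ω| ^ p ≤ _
        rw [← hN ω]
        exact Real.rpow_le_rpow (hN0 ω) hω hp0.le
      · apply Real.exp_le_exp.2
        have : t ^ 2 * x ^ (p - 2) / (16 * D ^ 2) ≤ t ^ 2 * x ^ (p - 2) / (4 * D ^ 2) := by
          gcongr; norm_num
        linarith
    · have : {ω | (∑ i ∈ Finset.range m, |X i ω| ^ p) ^ (1 / p) ≤ x - t} = ∅ := by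
        ext ω
        simp only [Set.mem_ofPred_eq, Set.mem_empty_iff_false, iff_false, not_le]
        linarith [hN0 ω]
      rw [this]; simpa using hE0.le
  have hup : μ.real {ω | x + t ≤ (∑ i ∈ Finset.range m, |X i ω| ^ p) ^ (1 / p)}
      ≤ (3 + Real.exp (p ^ 2 / 2)) * E := by
    have hsub : {ω | x + t ≤ (∑ i ∈ Finset.range m, |X i ω| ^ p) ^ (1 / p)}
        ⊆ {ω | (x + t) ^ p ≤ ∑ i ∈ Finset.range m, |X i ω| ^ p} := fun ω hω => by
      change _ ≤ ∑ i ∈ Finset.range m, |X i ω| ^ p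
      rw [← hN ω]
      exact Real.rpow_le_rpow (by linarith) hω hp0.le
    have hexp := Real.exp_pos (p ^ 2 / 2)
    rcases le_total p 2 with hp2 | hp2
    · refine (measureReal_mono hsub).trans ((measureReal_le_sum_abs_rpow_le_of_le_two hp hp2 hK hD
        hKD hKpD hX hind hgD hint hint2 hmean hx hxm ht.le).trans ?_)
      have : Real.exp (-(t ^ 2 * x ^ (p - 2) / (16 * D ^ 2))) ≤ E :=
        Real.exp_le_exp.2 (by linarith)
      nlinarith
    · have hw : t ^ 2 / (16 * D ^ 2 * R ^ 2) ≤ t ^ 2 / (8 * D ^ 2) := by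
        refine div_le_div_of_nonneg_left (by positivity) (by positivity) ?_
        nlinarith [mul_le_mul_of_nonneg_left (one_le_pow₀ hR1 : 1 ≤ R ^ 2) (sq_nonneg D)]
      rcases le_total (2 * p * D) t with htp | htp
      · have hKD2 : K ^ 2 ≤ D := by
          rcases le_total K 1 with h | h
          · exact (pow_le_one₀ hK.le h).trans hD
          · rw [← Real.rpow_two]
            exact (Real.rpow_le_rpow_of_exponent_le h hp2).trans hKpD
        refine (measureReal_mono hsub).trans ((measureReal_le_sum_abs_rpow_le_of_two_le hp2 hK hD
          hKD hKD2 hX hind hgD hint hint2 hmean hx hxm htp).trans ?_)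
        have : Real.exp (-(t ^ 2 / (8 * D ^ 2))) ≤ E := Real.exp_le_exp.2 (by linarith)
        nlinarith
      -- For t ≤ 2pD the exponent is at most p²/2, so the prefactor exp(p²/2) makes the bound
      -- trivial.
      · have h1 : 1 ≤ Real.exp (p ^ 2 / 2) * E := by
          rw [hE, ← Real.exp_add]
          apply Real.one_le_exp
          have : t ^ 2 / (8 * D ^ 2) ≤ p ^ 2 / 2 := by
            rw [div_le_iff₀ (by positivity)]
            nlinarith [pow_le_pow_left₀ ht.le htp 2]
          linarith
        refine (measureReal_le_one).trans ?_
        nlinarith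
  calc μ.real {ω | t ≤ |(∑ i ∈ Finset.range m, |X i ω| ^ p) ^ (1 / p) - x|}
      ≤ μ.real ({ω | (∑ i ∈ Finset.range m, |X i ω| ^ p) ^ (1 / p) ≤ x - t}
          ∪ {ω | x + t ≤ (∑ i ∈ Finset.range m, |X i ω| ^ p) ^ (1 / p)}) := by
        refine measureReal_mono fun ω hω => ?_
        rcases le_abs'.1 (show t ≤ |_| from hω) with h | h
        · left; change _ ≤ x - t; linarith
        · right; change x + t ≤ _; linarith
    _ ≤ _ := measureReal_union_le _ _
    _ ≤ E + (3 + Real.exp (p ^ 2 / 2)) * E := add_le_add hlow hup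
    _ = _ := by ring

end

/-! ### From tails to ψ₂-norms, and centering -/

theorem orliczNorm_two_le {Ω : Type*} [MeasurableSpace Ω] {μ : Measure Ω} {Z : Ω → ℝ} {t : ℝ}
    (ht : 0 < t) (h : ∫⁻ ω, ENNReal.ofReal (Real.exp (Z ω ^ 2 / t ^ 2)) ∂μ ≤ 2) :
    orliczNorm μ 2 Z ≤ ENNReal.ofReal t := by
  refine iInf₂_le_of_le t.toNNReal ⟨Real.toNNReal_pos.2 ht, ?_⟩ le_rfl
  simpa only [Real.rpow_two, sq_abs, Real.coe_toNNReal t ht.le] using h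

theorem integrable_exp_of_lintegral_le {Ω : Type*} [MeasurableSpace Ω] {μ : Measure Ω} {Z : Ω → ℝ} {c : ℝ} (hZ : Measurable Z)
    (h : ∫⁻ ω, ENNReal.ofReal (Real.exp (Z ω ^ 2 / c)) ∂μ ≤ 2) :
    Integrable (fun ω => Real.exp (Z ω ^ 2 / c)) μ ∧ ∫ ω, Real.exp (Z ω ^ 2 / c) ∂μ ≤ 2 := by
  have hm : Measurable fun ω => Real.exp (Z ω ^ 2 / c) := by fun_prop
  have h0 : 0 ≤ᵐ[μ] fun ω => Real.exp (Z ω ^ 2 / c) := ae_of_all _ fun ω => (Real.exp_pos _).le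
  constructor
  · refine ⟨hm.aestronglyMeasurable, ?_⟩
    rw [hasFiniteIntegral_iff_ofReal h0]
    exact h.trans_lt (by simp)
  · rw [integral_eq_lintegral_of_nonneg_ae h0 hm.aestronglyMeasurable]
    exact ENNReal.toReal_le_of_le_ofReal (by norm_num) (by simpa using h)

section

variable {Ω : Type*} [MeasurableSpace Ω] {μ : Measure Ω} [IsProbabilityMeasure μ]

/-- A sub-Gaussian tail bounds the exponential square moment. -/
theorem lintegral_exp_sq_le_two_of_tail {Z : Ω → ℝ} {s k E₀ : ℝ} (hZ : Measurable Z)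
    (hs : 0 < s) (hk : 0 < k) (hE : 1 < E₀) (hkE : k ^ 2 = 1 + E₀)
    (htail : ∀ t, 0 < t → μ.real {ω | t ≤ |Z ω|} ≤ E₀ * Real.exp (-(t ^ 2 / s ^ 2))) :
    ∫⁻ ω, ENNReal.ofReal (Real.exp (Z ω ^ 2 / (k * s) ^ 2)) ∂μ ≤ 2 := by
  -- Layer cake: levels v ≤ 1 contribute at most 1, and levels v > 1 at most E₀ ∫ v^(-k²) dv =
  -- E₀/(k² - 1). The choice k² = 1 + E₀ makes this equal to 1.
  rw [lintegral_eq_lintegral_meas_le μ (ae_of_all _ fun ω => (Real.exp_pos _).le)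
    (by fun_prop), ← Set.Ioc_union_Ioi_eq_Ioi zero_le_one,
    lintegral_union measurableSet_Ioi Set.Ioc_disjoint_Ioi_same]
  have h1 : ∫⁻ v in Set.Ioc (0 : ℝ) 1, μ {ω | v ≤ Real.exp (Z ω ^ 2 / (k * s) ^ 2)} ≤ 1 := by
    calc _ ≤ ∫⁻ _v in Set.Ioc (0 : ℝ) 1, 1 := lintegral_mono fun v => prob_le_one
      _ = 1 := by simp
  have h2 : ∫⁻ v in Set.Ioi (1 : ℝ), μ {ω | v ≤ Real.exp (Z ω ^ 2 / (k * s) ^ 2)} ≤ 1 := by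
    have hk1 : -(k ^ 2) < -1 := by linarith
    calc _ ≤ ∫⁻ v in Set.Ioi (1 : ℝ), ENNReal.ofReal (E₀ * v ^ (-(k ^ 2))) := by
          refine setLIntegral_mono' measurableSet_Ioi fun v (hv : 1 < v) => ?_
          have hlog : 0 < Real.log v := Real.log_pos hv
          have hv0 : 0 < v := by linarith
          have hsub : {ω | v ≤ Real.exp (Z ω ^ 2 / (k * s) ^ 2)}
              ⊆ {ω | k * s * √(Real.log v) ≤ |Z ω|} := fun ω hω => by
            have h := (Real.log_le_iff_le_exp hv0).2 hω
            rw [le_div_iff₀ (by positivity)] at h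
            change k * s * √(Real.log v) ≤ |Z ω|
            refine (pow_le_pow_iff_left₀ (by positivity) (abs_nonneg _) two_ne_zero).1 ?_
            rw [sq_abs, mul_pow, Real.sq_sqrt hlog.le]
            linarith
          have h := (measureReal_mono (μ := μ) hsub).trans
            (htail (k * s * √(Real.log v)) (by positivity))
          rw [← ofReal_measureReal]
          refine ENNReal.ofReal_le_ofReal (h.trans_eq ?_)
          rw [Real.rpow_def_of_pos hv0, mul_pow, Real.sq_sqrt hlog.le]
          congr 2
          field_simp
      _ = ENNReal.ofReal (∫ v in Set.Ioi (1 : ℝ), E₀ * v ^ (-(k ^ 2))) := by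
          rw [ofReal_integral_eq_lintegral_ofReal]
          · exact (integrableOn_Ioi_rpow_of_lt hk1 one_pos).const_mul _
          · filter_upwards [ae_restrict_mem measurableSet_Ioi] with v hv
            have : (0 : ℝ) < v := lt_trans one_pos hv
            simp only [Pi.zero_apply]
            positivity
      _ ≤ 1 := by
          rw [integral_const_mul, integral_Ioi_rpow_of_lt hk1 one_pos, Real.one_rpow, hkE]
          rw [ENNReal.ofReal_le_one]
          have : -(1 + E₀) + 1 = -E₀ := by ring
          rw [this, neg_div_neg_eq, mul_one_div_cancel (by linarith)]
  calc _ ≤ (1 : ℝ≥0∞) + 1 := add_le_add h1 h2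
    _ = 2 := one_add_one_eq_two

theorem integrable_of_lintegral_exp_sq_le {Z : Ω → ℝ} {t : ℝ} (hZ : Measurable Z) (ht : 0 < t)
    (h : ∫⁻ ω, ENNReal.ofReal (Real.exp (Z ω ^ 2 / t ^ 2)) ∂μ ≤ 2) :
    Integrable Z μ ∧ (∫ ω, Z ω ∂μ) ^ 2 ≤ t ^ 2 := by
  obtain ⟨hi, hle⟩ := integrable_exp_of_lintegral_le hZ h
  have hsq : Integrable (fun ω => Z ω ^ 2) μ := by
    refine (hi.const_mul (t ^ 2)).mono' (by fun_prop) (ae_of_all _ fun ω => ?_)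
    rw [Real.norm_of_nonneg (sq_nonneg _), ← div_le_iff₀' (by positivity)]
    linarith [Real.add_one_le_exp (Z ω ^ 2 / t ^ 2)]
  have hL2 : MemLp Z 2 μ := (memLp_two_iff_integrable_sq hZ.aestronglyMeasurable).2 hsq
  refine ⟨hL2.integrable (by norm_num), ?_⟩
  have hvar := variance_nonneg Z μ
  rw [variance_eq_sub hL2] at hvar
  have h2 : ∫ ω, Z ω ^ 2 ∂μ ≤ t ^ 2 := by
    calc ∫ ω, Z ω ^ 2 ∂μ ≤ ∫ ω, t ^ 2 * (Real.exp (Z ω ^ 2 / t ^ 2) - 1) ∂μ := by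
          refine integral_mono hsq ((hi.sub (integrable_const 1)).const_mul _) fun ω => ?_
          change Z ω ^ 2 ≤ t ^ 2 * (Real.exp (Z ω ^ 2 / t ^ 2) - 1)
          rw [← div_le_iff₀' (by positivity)]
          linarith [Real.add_one_le_exp (Z ω ^ 2 / t ^ 2)]
      _ = t ^ 2 * (∫ ω, Real.exp (Z ω ^ 2 / t ^ 2) ∂μ - 1) := by
          rw [integral_const_mul, integral_sub hi (integrable_const 1)]; simp
      _ ≤ t ^ 2 := by nlinarith [sq_nonneg t]
  simp only [Pi.pow_apply] at hvar
  linarith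

/-- Centering costs at most a factor `3` in the exponential square moment. -/
theorem lintegral_exp_sq_sub_integral_le {Z : Ω → ℝ} {t : ℝ} (hZ : Measurable Z) (ht : 0 < t)
    (h : ∫⁻ ω, ENNReal.ofReal (Real.exp (Z ω ^ 2 / t ^ 2)) ∂μ ≤ 2) :
    ∫⁻ ω, ENNReal.ofReal (Real.exp ((Z ω - ∫ ω', Z ω' ∂μ) ^ 2 / (3 * t) ^ 2)) ∂μ ≤ 2 := by
  obtain ⟨hi, hle⟩ := integrable_exp_of_lintegral_le hZ h
  obtain ⟨-, hb⟩ := integrable_of_lintegral_exp_sq_le hZ ht h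
  set b := ∫ ω', Z ω' ∂μ with hbdef
  -- From (Z - b)² ≤ 2Z² + 2b² and b² ≤ t². The coefficients are chosen so that 5/4 + (3/8)·2 = 2.
  have hpt : ∀ ω, Real.exp ((Z ω - b) ^ 2 / (3 * t) ^ 2)
      ≤ 5 / 4 + 3 / 8 * Real.exp (Z ω ^ 2 / t ^ 2) := fun ω => by
    set w := Z ω ^ 2 / t ^ 2 with hw
    have hw0 : 0 ≤ w := by positivity
    have h1 : (Z ω - b) ^ 2 / (3 * t) ^ 2 ≤ 2 / 9 + 2 / 9 * w := by
      have hZw : Z ω ^ 2 = w * t ^ 2 := by rw [hw]; field_simp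
      rw [div_le_iff₀ (by positivity)]
      nlinarith [sq_nonneg (Z ω + b)]
    have h2 : Real.exp (2 / 9) ≤ 9 / 7 := by
      have := Real.add_one_le_exp (-(2 / 9 : ℝ))
      have h2 : Real.exp (-(2 / 9)) * Real.exp (2 / 9) = 1 := by rw [← Real.exp_add]; simp
      nlinarith [Real.exp_pos (2 / 9)]
    have h3 : Real.exp (2 / 9 * w) ^ 4 ≤ Real.exp w := by
      rw [← Real.exp_nat_mul]
      apply Real.exp_le_exp.2
      push_cast
      linarith
    have hv := Real.exp_pos (2 / 9 * w)
    set v := Real.exp (2 / 9 * w)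
    calc Real.exp ((Z ω - b) ^ 2 / (3 * t) ^ 2) ≤ Real.exp (2 / 9 + 2 / 9 * w) :=
          Real.exp_le_exp.2 h1
      _ = Real.exp (2 / 9) * v := Real.exp_add _ _
      _ ≤ 9 / 7 * v := by gcongr
      _ ≤ 5 / 4 + 3 / 8 * v ^ 4 := by nlinarith [sq_nonneg (v ^ 2 - 1), sq_nonneg (v - 6 / 7)]
      _ ≤ _ := by gcongr
  calc _ ≤ ∫⁻ ω, ENNReal.ofReal (5 / 4 + 3 / 8 * Real.exp (Z ω ^ 2 / t ^ 2)) ∂μ :=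
        lintegral_mono fun ω => ENNReal.ofReal_le_ofReal (hpt ω)
    _ = ENNReal.ofReal (∫ ω, (5 / 4 + 3 / 8 * Real.exp (Z ω ^ 2 / t ^ 2)) ∂μ) := by
        rw [ofReal_integral_eq_lintegral_ofReal]
        · exact (integrable_const _).add (hi.const_mul _)
        · exact ae_of_all _ fun ω => by simp only [Pi.zero_apply]; positivity
    _ ≤ 2 := by
        rw [integral_add (integrable_const _) (hi.const_mul _), integral_const_mul]
        rw [show (2 : ℝ≥0∞) = ENNReal.ofReal 2 by simp]
        apply ENNReal.ofReal_le_ofReal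
        simp
        linarith

end

/-! ### Lower bounds for the radius of the dual ball -/

theorem one_le_rad_ellBall (q : ℝ≥0∞) [Fact (1 ≤ q)] {m : ℕ} (hm : 1 ≤ m) :
    1 ≤ rad (ellBall q m) := by
  let i : Fin m := ⟨0, hm⟩
  have h : ∀ r : ℝ≥0∞, [Fact (1 ≤ r)] → ellNorm r (Pi.single i (1 : ℝ)) = 1 := fun r _ => by
    exact (PiLp.norm_single r (fun _ : Fin m => ℝ) i (1 : ℝ)).trans norm_one
  refine le_trans ?_ (le_iSup₂ (f := fun y (_ : y ∈ ellBall q m) => ENNReal.ofReal (ellNorm 2 y))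
    (Pi.single i (1 : ℝ)) (h q).le)
  simp [h 2]

/-- The test vector is constant with entries m^(-1/q); for q = ∞ the exponent is 0 and the entries
are 1. -/
theorem rpow_le_rad_ellBall (q : ℝ≥0∞) [Fact (1 ≤ q)] {m : ℕ} (hm : 1 ≤ m) :
    ENNReal.ofReal ((m : ℝ) ^ (1 / 2 - (1 / q).toReal)) ≤ rad (ellBall q m) := by
  have : Nonempty (Fin m) := ⟨⟨0, hm⟩⟩
  have hm0 : (0 : ℝ) < m := by exact_mod_cast hm
  set b : ℝ := (m : ℝ) ^ (-(1 / q).toReal) with hb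
  have h : ∀ r : ℝ≥0∞, [Fact (1 ≤ r)] →
      ellNorm r (Function.const (Fin m) b) = (m : ℝ) ^ ((1 / r).toReal - (1 / q).toReal) :=
    fun r _ => by
      unfold ellNorm
      rw [PiLp.norm_toLp_const', Real.norm_of_nonneg (by positivity), hb, sub_eq_add_neg,
        Real.rpow_add hm0]
      simp
  refine le_trans ?_ (le_iSup₂ (f := fun y (_ : y ∈ ellBall q m) => ENNReal.ofReal (ellNorm 2 y))
    (Function.const (Fin m) b) ((h q).trans (by simp)).le)
  rw [h 2]
  simp

/-- Conjugacy gives 1/2 - 1/q = 1/p - 1/2 = (1/p)(1 - p/2), which matches the scale R of the tail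
bound. -/
theorem ofReal_max_rpow_le_rad_ellBall {p : ℝ} {q : ℝ≥0∞} (hp : 1 ≤ p)
    (hpq : (ENNReal.ofReal p).HolderConjugate q) {m : ℕ} (hm : 1 ≤ m) :
    ENNReal.ofReal (max 1 (((m : ℝ) ^ (1 / p)) ^ (1 - p / 2))) ≤ rad (ellBall q m) := by
  have hp0 : 0 < p := by linarith
  have hinv : (ENNReal.ofReal p)⁻¹ + q⁻¹ = 1 := ENNReal.holderConjugate_iff.1 hpq
  have hq1 : Fact (1 ≤ q) := ⟨by
    rw [← ENNReal.inv_le_one, ← hinv]; exact le_add_self⟩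
  have hqinv : (1 / q).toReal = 1 - 1 / p := by
    have h := congrArg ENNReal.toReal hinv
    rw [ENNReal.toReal_add (by simp [hp0]) (ne_top_of_le_ne_top ENNReal.one_ne_top
      (ENNReal.inv_le_one.2 hq1.out)), ENNReal.toReal_inv, ENNReal.toReal_ofReal hp0.le] at h
    rw [one_div, one_div]
    simp only [ENNReal.toReal_one] at h
    linarith
  rw [ENNReal.ofReal_max]
  refine max_le (by simpa using one_le_rad_ellBall q hm) ?_
  have e : ((m : ℝ) ^ (1 / p)) ^ (1 - p / 2) = (m : ℝ) ^ (1 / 2 - (1 / q).toReal) := by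
    rw [hqinv, ← Real.rpow_mul (Nat.cast_nonneg m)]
    congr 1
    field_simp
    ring
  rw [e]
  exact rpow_le_rad_ellBall q hm

/-! ### Translation of the norms and assembly -/

theorem ellNorm_ofReal_eq {p : ℝ} (hp : 0 < p) {m : ℕ} (a : ℕ → ℝ) :
    ellNorm (ENNReal.ofReal p) (fun i : Fin m => a i)
      = (∑ i ∈ Finset.range m, |a i| ^ p) ^ (1 / p) := by
  unfold ellNorm
  rw [PiLp.norm_eq_sum (by rwa [ENNReal.toReal_ofReal hp.le]), ENNReal.toReal_ofReal hp.le]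
  simp only [Real.norm_eq_abs]
  rw [← Fin.sum_univ_eq_sum_range (fun i => |a i| ^ p)]

theorem integral_abs_rpow_eq_one {Ω : Type*} [MeasurableSpace Ω] {μ : Measure Ω} {Y : Ω → ℝ} {p : ℝ} (hp : 0 < p) (hY : Measurable Y)
    (h : eLpNorm Y (ENNReal.ofReal p) μ = 1) : ∫ ω, |Y ω| ^ p ∂μ = 1 := by
  rw [eLpNorm_eq_lintegral_rpow_enorm_toReal (by simpa using hp) ENNReal.ofReal_ne_top,
    ENNReal.toReal_ofReal hp.le] at h
  have h1 : ∫⁻ ω, ‖Y ω‖ₑ ^ p ∂μ = 1 := by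
    have := congrArg (· ^ p) h
    simpa [← ENNReal.rpow_mul, hp.ne'] using this
  rw [integral_eq_lintegral_of_nonneg_ae (ae_of_all _ fun ω => by positivity)
    (hY.abs.pow_const p).aestronglyMeasurable]
  have e : ∀ ω, ENNReal.ofReal (|Y ω| ^ p) = ‖Y ω‖ₑ ^ p := fun ω => by
    rw [← Real.norm_eq_abs, ← ENNReal.ofReal_rpow_of_nonneg (norm_nonneg _) hp.le,
      ofReal_norm]
  simp only [e, h1, ENNReal.toReal_one]

/-- A bound by every admissible scale of `orliczNorm` passes to the infimum. -/
theorem le_mul_orliczNorm_rpow_mul {Ω : Type*} [MeasurableSpace Ω] {μ : Measure Ω}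
    {Y : Ω → ℝ} {p : ℝ} (hp : 0 < p) {A C R : ℝ≥0∞} (hC : C ≠ ∞) (hR : R ≠ ∞)
    (hY : IsSubGaussian μ Y)
    (h : ∀ K : ℝ, 0 < K → ∫⁻ ω, ENNReal.ofReal (Real.exp (Y ω ^ 2 / K ^ 2)) ∂μ ≤ 2 →
      A ≤ C * ENNReal.ofReal (K ^ p) * R) :
    A ≤ C * orliczNorm μ 2 Y ^ p * R := by
  have hY' : orliczNorm μ 2 Y ≠ ∞ := ne_of_lt hY
  have key : ∀ y, orliczNorm μ 2 Y < y → A ≤ C * y ^ p * R := fun y hy => by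
    obtain ⟨t, ht⟩ := iInf_lt_iff.1 hy
    obtain ⟨⟨ht0, hle⟩, hty⟩ := iInf_lt_iff.1 ht
    refine (h t ht0 (by simpa only [Real.rpow_two, sq_abs] using hle)).trans ?_
    have e : ENNReal.ofReal ((t : ℝ) ^ p) = (t : ℝ≥0∞) ^ p := by
      rw [← ENNReal.ofReal_rpow_of_nonneg t.coe_nonneg hp.le, ENNReal.ofReal_coe_nnreal]
    rw [e]
    gcongr
  -- The bound holds at every y above the infimum; letting y decrease to it avoids asking whether it
  -- is attained or positive. Continuity uses that C and R are finite.
  have hcont : Continuous fun y : ℝ≥0∞ => C * y ^ p * R :=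
    (ENNReal.continuous_mul_const hR).comp
      ((ENNReal.continuous_const_mul hC).comp ENNReal.continuous_rpow_const)
  have : (nhdsWithin (orliczNorm μ 2 Y) (Set.Ioi (orliczNorm μ 2 Y))).NeBot :=
    nhdsGT_neBot_of_exists_gt ⟨∞, hY'.lt_top⟩
  have hev : ∀ᶠ y in nhdsWithin (orliczNorm μ 2 Y) (Set.Ioi (orliczNorm μ 2 Y)),
      A ≤ C * y ^ p * R := by
    filter_upwards [self_mem_nhdsWithin] with y hy using key y hy
  exact ge_of_tendsto ((hcont.tendsto _).mono_left nhdsWithin_le_nhds) hev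

section

variable {Ω : Type*} [MeasurableSpace Ω] {μ : Measure Ω} [IsProbabilityMeasure μ]

theorem lintegral_exp_sq_norm_sub_le {X : ℕ → Ω → ℝ} {p K : ℝ} {m : ℕ} (hp : 1 ≤ p) (hK : 0 < K)
    (hX : ∀ i, Measurable (X i)) (hind : iIndepFun X μ)
    (hexp : ∀ i, ∫⁻ ω, ENNReal.ofReal (Real.exp (X i ω ^ 2 / K ^ 2)) ∂μ ≤ 2)
    (hmean : ∀ i, ∫ ω, |X i ω| ^ p ∂μ = 1) (hm : 1 ≤ m) :
    ∫⁻ ω, ENNReal.ofReal (Real.exp (((∑ i ∈ Finset.range m, |X i ω| ^ p) ^ (1 / p)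
        - (m : ℝ) ^ (1 / p)) ^ 2 / (√(5 + Real.exp (p ^ 2 / 2)) *
          (4 * (2 * (4 * p) ^ (p / 2) * K ^ p) * max 1 (((m : ℝ) ^ (1 / p)) ^ (1 - p / 2)))) ^ 2))
        ∂μ ≤ 2 := by
  have hp0 : 0 < p := by linarith
  have hint := fun i => (integrable_exp_of_lintegral_le (hX i) (hexp i)).1
  have hint2 := fun i => (integrable_exp_of_lintegral_le (hX i) (hexp i)).2
  have hgD := abs_rpow_sq_le hp hK
  have h4p : 1 ≤ (4 * p) ^ (p / 2) := Real.one_le_rpow (by linarith) (by linarith)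
  have hKp : 0 < K ^ p := Real.rpow_pos_of_pos hK p
  have hKpD : K ^ p ≤ 2 * (4 * p) ^ (p / 2) * K ^ p := by nlinarith
  have hD0 : 0 < 2 * (4 * p) ^ (p / 2) * K ^ p := by positivity
  set D := 2 * (4 * p) ^ (p / 2) * K ^ p
  -- Integrating 2a - 1 ≤ a² with a = |X₀|^p, whose mean is 1, gives 1 ≤ E a² ≤ D²/2.
  have hD : 1 ≤ D := by
    have hi := integrable_of_sq_le_mul_exp hK (hX 0) (g := fun y => |y| ^ p) (by fun_prop)
      (fun y => by positivity) hgD (hint 0)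
    have h1 : ∫ ω, (2 * |X 0 ω| ^ p - 1) ∂μ
        ≤ ∫ ω, D ^ 2 / 4 * Real.exp (X 0 ω ^ 2 / K ^ 2) ∂μ := by
      refine integral_mono ((hi.const_mul 2).sub (integrable_const 1)) ((hint 0).const_mul _)
        fun ω => ?_
      have h2 : Real.exp (X 0 ω ^ 2 / (4 * K ^ 2)) ≤ Real.exp (X 0 ω ^ 2 / K ^ 2) := by
        refine Real.exp_le_exp.2 (div_le_div_of_nonneg_left (sq_nonneg _) (by positivity) ?_)
        nlinarith [sq_nonneg K]
      have h3 := mul_le_mul_of_nonneg_left h2 (by positivity : 0 ≤ D ^ 2 / 4)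
      change 2 * |X 0 ω| ^ p - 1 ≤ D ^ 2 / 4 * Real.exp (X 0 ω ^ 2 / K ^ 2)
      nlinarith [sq_nonneg (|X 0 ω| ^ p - 1), hgD (X 0 ω)]
    rw [integral_sub (hi.const_mul 2) (integrable_const 1), integral_const_mul, hmean 0,
      integral_const_mul] at h1
    have h5 := hint2 0
    simp only [integral_const, probReal_univ, smul_eq_mul] at h1
    by_contra! hlt
    have : D ^ 2 < 1 := by nlinarith
    nlinarith
  have hKD : K ≤ D := by
    rcases le_total K 1 with h | h
    · exact h.trans hD
    · calc K = K ^ (1 : ℝ) := (Real.rpow_one K).symm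
        _ ≤ K ^ p := Real.rpow_le_rpow_of_exponent_le h hp
        _ ≤ D := hKpD
  have hm1 : (1 : ℝ) ≤ m := by exact_mod_cast hm
  have hx : 1 ≤ (m : ℝ) ^ (1 / p) := Real.one_le_rpow hm1 (by positivity)
  have hxm : ((m : ℝ) ^ (1 / p)) ^ p = m := by
    rw [← Real.rpow_mul (by linarith), one_div_mul_cancel hp0.ne', Real.rpow_one]
  have hE := Real.exp_pos (p ^ 2 / 2)
  have hR1 : 1 ≤ max 1 (((m : ℝ) ^ (1 / p)) ^ (1 - p / 2)) := le_max_left _ _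
  refine lintegral_exp_sq_le_two_of_tail (E₀ := 4 + Real.exp (p ^ 2 / 2)) (by fun_prop)
    (by positivity) (by positivity) (by linarith) ?_ fun t ht => ?_
  · rw [Real.sq_sqrt (by positivity)]; ring
  · refine (measureReal_le_abs_norm_sub_le hp hK hD hKD hKpD hX hind hgD hint hint2 hmean hx hxm
      hR1 (le_max_right _ _) ht).trans_eq ?_
    congr 4
    ring

end

theorem theorem3p2 (p : ℝ) (hp : 1 ≤ p) (q : ℝ≥0∞)
    (hpq : (ENNReal.ofReal p).HolderConjugate q) :
    ∃ C : ℝ≥0, 0 < C ∧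
      ∀ (Ω : Type*) [MeasurableSpace Ω] (μ : Measure Ω) [IsProbabilityMeasure μ]
        (X : ℕ → Ω → ℝ),
        (∀ i, Measurable (X i)) →
        iIndepFun X μ →
        (∀ i, IdentDistrib (X i) (X 0) μ μ) →
        IsSubGaussian μ (X 0) →
        eLpNorm (X 0) (ENNReal.ofReal p) μ = 1 →
        ∀ m : ℕ, 1 ≤ m →
          orliczNorm μ 2
              (fun ω => ellNorm (ENNReal.ofReal p) (fun i : Fin m => X i ω)
                - (m : ℝ) ^ (1 / p))
            ≤ C * orliczNorm μ 2 (X 0) ^ p * rad (ellBall q m) ∧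
          Integrable (fun ω => ellNorm (ENNReal.ofReal p) (fun i : Fin m => X i ω)) μ ∧
          orliczNorm μ 2
              (fun ω => ellNorm (ENNReal.ofReal p) (fun i : Fin m => X i ω)
                - ∫ ω', ellNorm (ENNReal.ofReal p) (fun i : Fin m => X i ω') ∂μ)
            ≤ C * orliczNorm μ 2 (X 0) ^ p * rad (ellBall q m) := by
  have hp0 : 0 < p := by linarith
  -- The root is k with k² = 1 + E₀ for the tail prefactor E₀ = 4 + exp(p²/2). The rest is 4D/K^p,
  -- where 4 is the root of the 16 in the tail exponent. The factor 3 in the final constant pays for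
  -- centering.
  set c : ℝ := √(5 + Real.exp (p ^ 2 / 2)) * (8 * (4 * p) ^ (p / 2)) with hc
  have hc0 : 0 < c := by positivity
  refine ⟨(3 * c).toNNReal, by simpa using hc0, ?_⟩
  intro Ω _ μ _ X hX hind hid hsub hLp m hm
  have hmean0 := integral_abs_rpow_eq_one hp0 (hX 0) hLp
  have hmean : ∀ i, ∫ ω, |X i ω| ^ p ∂μ = 1 := fun i =>
    ((hid i).comp (u := fun y : ℝ => |y| ^ p) (by fun_prop)).integral_eq.trans hmean0
  have hNeq : ∀ ω, ellNorm (ENNReal.ofReal p) (fun i : Fin m => X i ω)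
      = (∑ i ∈ Finset.range m, |X i ω| ^ p) ^ (1 / p) := fun ω =>
    ellNorm_ofReal_eq hp0 fun i => X i ω
  simp only [hNeq]
  set N : Ω → ℝ := fun ω => (∑ i ∈ Finset.range m, |X i ω| ^ p) ^ (1 / p) with hN
  set x : ℝ := (m : ℝ) ^ (1 / p) with hx
  set R : ℝ := max 1 (x ^ (1 - p / 2)) with hR
  have hR0 : 0 < R := lt_of_lt_of_le one_pos (le_max_left _ _)
  have hNm : Measurable N := by fun_prop
  have hZm : Measurable fun ω => N ω - x := hNm.sub_const x
  have hRrad : ENNReal.ofReal R ≤ rad (ellBall q m) := ofReal_max_rpow_le_rad_ellBall hp hpq hm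
  have main : ∀ K : ℝ, 0 < K → ∫⁻ ω, ENNReal.ofReal (Real.exp (X 0 ω ^ 2 / K ^ 2)) ∂μ ≤ 2 →
      0 < c * K ^ p * R ∧
      ∫⁻ ω, ENNReal.ofReal (Real.exp ((N ω - x) ^ 2 / (c * K ^ p * R) ^ 2)) ∂μ ≤ 2 := by
    intro K hK h0
    have hexp : ∀ i, ∫⁻ ω, ENNReal.ofReal (Real.exp (X i ω ^ 2 / K ^ 2)) ∂μ ≤ 2 := fun i =>
      ((hid i).comp (u := fun y : ℝ => ENNReal.ofReal (Real.exp (y ^ 2 / K ^ 2)))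
        (by fun_prop)).lintegral_eq.trans_le h0
    have h := lintegral_exp_sq_norm_sub_le hp hK hX hind hexp hmean hm
    have e : √(5 + Real.exp (p ^ 2 / 2)) * (4 * (2 * (4 * p) ^ (p / 2) * K ^ p) * R)
        = c * K ^ p * R := by rw [hc]; ring
    rw [← hx, ← hR, e] at h
    exact ⟨by positivity, h⟩
  have hfin : ∀ {A : ℝ≥0∞}, (∀ K : ℝ, 0 < K →
      ∫⁻ ω, ENNReal.ofReal (Real.exp (X 0 ω ^ 2 / K ^ 2)) ∂μ ≤ 2 →
        A ≤ ENNReal.ofReal (3 * (c * K ^ p * R))) →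
      A ≤ ((3 * c).toNNReal : ℝ≥0∞) * orliczNorm μ 2 (X 0) ^ p * rad (ellBall q m) := by
    intro A hA
    -- The limit is taken with the finite R and only then compared with the radius, so finiteness of
    -- the radius is not needed.
    refine (le_mul_orliczNorm_rpow_mul (C := ((3 * c).toNNReal : ℝ≥0∞)) (R := ENNReal.ofReal R)
      hp0 ENNReal.coe_ne_top ENNReal.ofReal_ne_top hsub fun K hK h0 => (hA K hK h0).trans_eq ?_).trans
      (by gcongr)
    change _ = ENNReal.ofReal (3 * c) * _ * _
    rw [← ENNReal.ofReal_mul (by positivity), ← ENNReal.ofReal_mul (by positivity)]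
    congr 1; ring
  obtain ⟨K₀, hK₀, hle₀⟩ : ∃ K : ℝ, 0 < K ∧
      ∫⁻ ω, ENNReal.ofReal (Real.exp (X 0 ω ^ 2 / K ^ 2)) ∂μ ≤ 2 := by
    obtain ⟨t, ht⟩ := iInf_lt_iff.1 hsub
    obtain ⟨⟨ht0, hle⟩, -⟩ := iInf_lt_iff.1 ht
    exact ⟨t, ht0, by simpa only [Real.rpow_two, sq_abs] using hle⟩
  have hNi : Integrable N μ := by
    obtain ⟨hpos, h⟩ := main K₀ hK₀ hle₀
    have := (integrable_of_lintegral_exp_sq_le hZm hpos h).1.add (integrable_const x)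
    refine this.congr (ae_of_all _ fun ω => ?_)
    simp
  refine ⟨hfin fun K hK h0 => ?_, hNi, hfin fun K hK h0 => ?_⟩
  · obtain ⟨hpos, h⟩ := main K hK h0
    exact (orliczNorm_two_le hpos h).trans (ENNReal.ofReal_le_ofReal (by linarith))
  · obtain ⟨hpos, h⟩ := main K hK h0
    have h' := lintegral_exp_sq_sub_integral_le hZm hpos h
    have e : ∀ ω, N ω - x - ∫ ω', (N ω' - x) ∂μ = N ω - ∫ ω', N ω' ∂μ := fun ω => by
      rw [integral_sub hNi (integrable_const x)]
      simp
    simp only [e] at h'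
    exact orliczNorm_two_le (by positivity) h'
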